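/- Let $\mathbf{Mnd}_f(\mathbf{Set})$ be the category of finitary monads on $\mathbf{Set}$ (monads whose underlying endofunctor preserves filtered colimits) and monad morphisms, and let $\mathbf{Alg}\colon \mathbf{Mnd}_f(\mathbf{Set})^{\mathrm{op}}\to\mathbf{CAT}$ send a monad to its category of Eilenberg–Moore algebras and a monad morphism to restriction along it. A *Lawvere theory* is a category $\mathcal T$ with finite products whose objects are the distinct finite powers $X^n$ ($n\in\mathbb N$) of a distinguished object $X=X^1$, the product projections $\pi_i\colon X^n\to X$ being chosen (with $\pi_1\colon X^1\to X$ the identity). A morphism of Lawvere theories is a functor strictly preserving the distinguished object and its finite powers, including the projections. These form a category $\mathbf{Law}$. A *model* of $\mathcal T$ is a finite-product-preserving functor $\mathcal T\to\mathbf{Set}$; models and natural transformations form a category $\mathbf{Mod}(\mathcal T)$, and precomposition gives a functor $\mathbf{Mod}\colon\mathbf{Law}^{\mathrm{op}}\to\mathbf{CAT}$. Let $\mathcal F$ be the category of finite cardinals and give $[\mathcal F,\mathbf{Set}]$ the monoidal structure that corresponds to composition of finitary endofunctors of $\mathbf{Set}$. An $[\mathcal F,\mathbf{Set}]$-category $\mathcal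 M$ thus has hom-sets $\mathcal M_n(X,Y)$, functorial in $n\in\mathcal F$, identities in $\mathcal M_1(X,X)$, and compositions $\mathcal M_m(Y,Z)\times\mathcal M_n(X,Y)^m\to\mathcal M_n(X,Z)$. For a monad $T$ on $\mathbf{Set}$ let $\Sigma T$ be the one-object $[\mathcal F,\mathbf{Set}]$-category with $(\Sigma T)_n=T(n)$ and with identity and composition given by the unit and multiplication of $T$. For an $[\mathcal F,\mathbf{Set}]$-category $\mathcal M$ let $L\mathcal M$ be its representable completion: its objects are the formal tensors $X^{(n)}$ of objects $X$ of $\mathcal M$ by the representables $\mathcal F(n,-)$, $n\in\mathbb N$, its homs are $(L\mathcal M)_k(X^{(n)},Y^{(m)})=\mathcal M_{nk}(X,Y)^m$, its identities are tuples of projections, and its composition is induced by that of $\mathcal M$. The underlying ordinary category of $L(\Sigma T)$ (with homs the $L(\Sigma T)_1$), with distinguished object $X^{(1)}$ for $X$ the unique object of $\Sigma T$, is a Lawvere theory, functorially in $T$. **Proposition.** There is an equivalence of categories $E\colon\mathbf{Mnd}_f(\mathbf{Set})\simeq\mathbf{Law}$ that is naturally isomorphic to $T\mapsto L(\Sigma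 T)$, and there is a pseudonatural equivalence $$\mathbf{Alg}\;\simeq\;\mathbf{Mod}\circ E^{\mathrm{op}}\colon\ \mathbf{Mnd}_f(\mathbf{Set})^{\mathrm{op}}\to\mathbf{CAT},$$ that is, a pseudonatural transformation whose components $\mathbf{Alg}(T)\to\mathbf{Mod}(E(T))$ are equivalences of categories. -/

import Mathlib

open CategoryTheory CategoryTheory.Limits

universe u v

namespace MonadTheory

/-! ### Finitary monads on the category of sets -/

/-- A monad on `Type u` is finitary if its underlying endofunctor preserves filtered colimits. -/
def isFinitary : ObjectProperty (Monad (Type u)) :=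
  fun T => PreservesFilteredColimits (T : Type u ⥤ Type u)

/-- The category `Mnd_f(Set)` of finitary monads on `Type u` and all monad morphisms. -/
abbrev FinitaryMonad : Type (u + 1) := (isFinitary.{u}).FullSubcategory

theorem algebra_eqToHom_f {T : Monad (Type u)} {A B : T.Algebra} (h : A = B) :
    (eqToHom h).f = eqToHom (congrArg Monad.Algebra.A h) := by
  subst h
  rfl

theorem algebraFunctor_id (T : Monad (Type u)) :
    Monad.algebraFunctorOfMonadHom (𝟙 T) = 𝟭 T.Algebra := by
  refine CategoryTheory.Functor.ext (h_obj := fun A => ?_) (h_map := fun A B f => ?_)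
  · change Monad.Algebra.mk A.A (𝟙 _ ≫ A.a) _ _ = Monad.Algebra.mk A.A A.a _ _
    congr 1
  · apply Monad.Algebra.Hom.ext
    rw [Monad.Algebra.comp_f, Monad.Algebra.comp_f, algebra_eqToHom_f, algebra_eqToHom_f]
    rfl

theorem algebraFunctor_comp {R S T : Monad (Type u)} (f : R ⟶ S) (g : S ⟶ T) :
    Monad.algebraFunctorOfMonadHom (f ≫ g) =
      Monad.algebraFunctorOfMonadHom g ⋙ Monad.algebraFunctorOfMonadHom f := by
  have h (A : T.Algebra) : (Monad.algebraFunctorOfMonadHom (f ≫ g)).obj A =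
      (Monad.algebraFunctorOfMonadHom g ⋙ Monad.algebraFunctorOfMonadHom f).obj A := rfl
  refine CategoryTheory.Functor.ext (h_obj := h) (h_map := fun A B k => ?_)
  · apply Monad.Algebra.Hom.ext
    rw [Monad.Algebra.comp_f, Monad.Algebra.comp_f, algebra_eqToHom_f, algebra_eqToHom_f]
    rfl

/-- The functor `Alg`, sending a finitary monad to its category of Eilenberg–Moore algebras and a
monad morphism `S ⟶ T` to the functor `Alg T ⥤ Alg S` that restricts the action along it. -/
def algebras : FinitaryMonad.{u}ᵒᵖ ⥤ Cat.{u, u + 1} where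
  obj T := Cat.of T.unop.obj.Algebra
  map f := (Monad.algebraFunctorOfMonadHom f.unop.hom).toCatHom
  map_id T := congrArg Functor.toCatHom (algebraFunctor_id T.unop.obj)
  map_comp f g := congrArg Functor.toCatHom (algebraFunctor_comp g.unop.hom f.unop.hom)

/-! ### Finite products of finite powers -/

section Products

variable {C : Type*} [Category C]

theorem fan_isLimit_iff {J : Type*} {f : J → C} (P : C) (p : ∀ j, P ⟶ f j) :
    Nonempty (IsLimit (Fan.mk P p)) ↔
      ∀ Z : C, Function.Bijective (fun (g : Z ⟶ P) (j : J) => g ≫ p j) := by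
  constructor
  · rintro ⟨h⟩ Z
    refine ⟨fun g g' e => Fan.IsLimit.hom_ext h _ _ fun j => congrFun e j, fun k => ?_⟩
    exact ⟨Fan.IsLimit.lift h k, funext fun j => Fan.IsLimit.fac h k j⟩
  · intro h
    refine ⟨Fan.IsLimit.mk _ (fun s => ((h s.pt).2 s.proj).choose) (fun s j => ?_)
      (fun s m hm => (h s.pt).1 ?_)⟩
    · exact congrFun ((h s.pt).2 s.proj).choose_spec j
    · refine Eq.trans (funext hm) ((h s.pt).2 s.proj).choose_spec.symm

theorem fan_sigma_isLimit_iff {J : Type*} {K : J → Type*} {X P : C} {f : J → C}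
    (p : ∀ j, P ⟶ f j) (q : ∀ j, K j → (f j ⟶ X))
    (hq : ∀ j, Nonempty (IsLimit (Fan.mk (f j) (q j)))) :
    Nonempty (IsLimit (Fan.mk P (fun a : Σ j, K j => p a.1 ≫ q a.1 a.2))) ↔
      Nonempty (IsLimit (Fan.mk P p)) := by
  simp only [fan_isLimit_iff] at hq ⊢
  refine forall_congr' fun Z => ?_
  let e : (∀ j, Z ⟶ f j) ≃ ((Σ j, K j) → (Z ⟶ X)) :=
    (Equiv.piCongrRight fun j => Equiv.ofBijective _ (hq j Z)).trans
      (Equiv.piCurry (fun (j : J) (_ : K j) => (Z ⟶ X))).symm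
  have : (fun (g : Z ⟶ P) (a : Σ j, K j) => g ≫ p a.1 ≫ q a.1 a.2) =
      e ∘ fun (g : Z ⟶ P) (j : J) => g ≫ p j := by
    funext g a
    simp [e, Equiv.piCurry, Sigma.uncurry]
  rw [this]
  exact e.bijective.of_comp_iff' _

theorem fan_reindex_isLimit_iff {J K : Type*} {X P : C} (e : K ≃ J) (p : J → (P ⟶ X)) :
    Nonempty (IsLimit (Fan.mk P (fun k => p (e k)))) ↔ Nonempty (IsLimit (Fan.mk P p)) := by
  simp only [fan_isLimit_iff]
  refine forall_congr' fun Z => ?_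
  exact (Equiv.arrowCongr e.symm (Equiv.refl (Z ⟶ X))).bijective.of_comp_iff'
    (fun (g : Z ⟶ P) (j : J) => g ≫ p j)

theorem fan_isLimit_of_iso {J : Type*} {f : J → C} {P Q : C} (u : P ≅ Q) (p : ∀ j, P ⟶ f j)
    (q : ∀ j, Q ⟶ f j) (hu : ∀ j, u.hom ≫ q j = p j)
    (h : Nonempty (IsLimit (Fan.mk Q q))) : Nonempty (IsLimit (Fan.mk P p)) :=
  h.map fun h => h.ofIsoLimit (Fan.ext u.symm fun j => by simp [← hu])

variable {X : C} {P : ℕ → C} (π : ∀ n, Fin n → (P n ⟶ X))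

/-- A category in which every object is a chosen finite power of one object has finite products. -/
theorem hasFiniteProducts_of_powers (hP : Function.Surjective P)
    (hπ : ∀ n, Nonempty (IsLimit (Fan.mk (P n) (π n)))) : HasFiniteProducts C := by
  refine ⟨fun k => ⟨fun D => ?_⟩⟩
  suffices h : HasLimit (Discrete.functor (fun j => D.obj ⟨j⟩)) from
    hasLimit_of_iso (F := Discrete.functor (fun j => D.obj ⟨j⟩))
      (Discrete.natIso fun _ => Iso.refl _)
  choose n hn using fun j => hP (D.obj ⟨j⟩)
  have hq : ∀ j, Nonempty (IsLimit (Fan.mk (D.obj ⟨j⟩)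
      (fun i => eqToHom (hn j).symm ≫ π (n j) i))) := fun j =>
    fan_isLimit_of_iso (eqToIso (hn j).symm) _ _ (fun _ => rfl) (hπ (n j))
  let e := Fintype.equivFin (Σ j, Fin (n j))
  have hK := (fan_reindex_isLimit_iff e _).2 (hπ (Fintype.card (Σ j, Fin (n j))))
  choose l hl using fun j => ((fan_isLimit_iff _ _).1 (hq j) _).2 (fun i => π _ (e ⟨j, i⟩))
  obtain ⟨h⟩ := (fan_sigma_isLimit_iff l _ hq).1 (by
    convert hK using 5 with a
    exact congrFun (hl a.1) a.2)
  exact ⟨⟨⟨_, h⟩⟩⟩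

/-- If every object of `C` is a chosen finite power of one object, then a functor out of `C` that
preserves these powers preserves all finite products. -/
theorem preservesFiniteProducts_of_powers {D : Type*} [Category D] (F : C ⥤ D)
    (hP : Function.Surjective P) (hπ : ∀ n, Nonempty (IsLimit (Fan.mk (P n) (π n))))
    (hF : ∀ n, Nonempty (IsLimit (Fan.mk (F.obj (P n)) (fun i => F.map (π n i))))) :
    PreservesFiniteProducts F := by
  -- any finite power cone of `X` is preserved
  have key : ∀ {K : Type} [Fintype K] {Q : C} (p : K → (Q ⟶ X)),
      Nonempty (IsLimit (Fan.mk Q p)) →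
      Nonempty (IsLimit (Fan.mk (F.obj Q) (fun k => F.map (p k)))) := by
    intro K _ Q p hp
    let e := Fintype.equivFin K
    obtain ⟨h₁⟩ := hp
    obtain ⟨h₂⟩ := (fan_reindex_isLimit_iff e _).2 (hπ (Fintype.card K))
    refine fan_isLimit_of_iso (F.mapIso (h₁.conePointUniqueUpToIso h₂)) _ _ (fun k => ?_)
      ((fan_reindex_isLimit_iff e _).2 (hF (Fintype.card K)))
    have := h₁.conePointUniqueUpToIso_hom_comp h₂ ⟨k⟩
    dsimp at this ⊢
    rw [← F.map_comp]
    exact congrArg _ this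
  refine ⟨fun k => ⟨fun {E} => ?_⟩⟩
  suffices h : PreservesLimit (Discrete.functor (fun j => E.obj ⟨j⟩)) F from
    preservesLimit_of_iso_diagram F (K₁ := Discrete.functor (fun j => E.obj ⟨j⟩))
      (Discrete.natIso fun _ => Iso.refl _)
  refine ⟨fun {c} hc => ?_⟩
  choose n hn using fun j => hP (E.obj ⟨j⟩)
  have hq : ∀ j, Nonempty (IsLimit (Fan.mk (E.obj ⟨j⟩)
      (fun i => eqToHom (hn j).symm ≫ π (n j) i))) := fun j =>
    fan_isLimit_of_iso (eqToIso (hn j).symm) _ _ (fun _ => rfl) (hπ (n j))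
  let c' : Fan (fun j => E.obj ⟨j⟩) := c
  have hc' : Nonempty (IsLimit (Fan.mk c'.pt c'.proj)) :=
    ⟨hc.ofIsoLimit (Fan.ext (Iso.refl _) (fun j => by
      simp only [Iso.refl_hom, Category.id_comp]; rfl))⟩
  have h₁ := key _ ((fan_sigma_isLimit_iff c'.proj _ hq).2 hc')
  have h₂ := fan_sigma_isLimit_iff (fun j => F.map (c'.proj j))
    (fun j i => F.map (eqToHom (hn j).symm ≫ π (n j) i)) (fun j => key _ (hq j))
  obtain ⟨h₃⟩ := h₂.1 (by simpa only [Functor.map_comp] using h₁)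
  exact ⟨(Fan.isLimitMapConeEquiv F _ c').symm h₃⟩

end Products

/-! ### Lawvere theories and their models -/

/-- A Lawvere theory: a (small) category whose objects are the distinct finite powers
`X ^ n = pow n` of a distinguished object `X = pow 1`, with the product projections
`π n i : X ^ n ⟶ X` chosen (and `X ^ 1 = X` being the trivial power). Such a category has finite
products, see `LawvereTheory.hasFiniteProducts`. -/
structure LawvereTheory where
  /-- The objects. -/
  Obj : Type u
  /-- The category structure. -/
  [category : Category.{u} Obj]
  /-- The finite powers of the distinguished object `pow 1`. -/
  pow : ℕ → Obj
  /-- The objects are the distinct powers. -/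
  pow_bijective : Function.Bijective pow
  /-- The product projections. -/
  π (n : ℕ) (i : Fin n) : pow n ⟶ pow 1
  /-- `pow n` is the `n`-fold power of the distinguished object. -/
  isPower (n : ℕ) : Nonempty (IsLimit (Fan.mk (pow n) (π n)))
  π_one : π 1 0 = 𝟙 (pow 1)

namespace LawvereTheory

attribute [instance] LawvereTheory.category

instance hasFiniteProducts (L : LawvereTheory.{u}) : HasFiniteProducts L.Obj :=
  hasFiniteProducts_of_powers L.π L.pow_bijective.2 L.isPower

/-- A morphism of Lawvere theories: a functor that strictly preserves the distinguished object and
its finite powers, projections included. -/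
@[ext]
structure Hom (L L' : LawvereTheory.{u}) where
  /-- The underlying functor. -/
  toFunctor : L.Obj ⥤ L'.Obj
  obj_pow (n : ℕ) : toFunctor.obj (L.pow n) = L'.pow n
  map_π (n : ℕ) (i : Fin n) : toFunctor.map (L.π n i) =
    eqToHom (obj_pow n) ≫ L'.π n i ≫ eqToHom (obj_pow 1).symm

/-- The category `Law` of Lawvere theories. -/
instance : Category LawvereTheory.{u} where
  Hom := Hom
  id L := ⟨𝟭 _, fun _ => rfl, by simp⟩
  comp F G := ⟨F.toFunctor ⋙ G.toFunctor, by simp [Hom.obj_pow], by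
    intro n i
    simp [Hom.map_π, eqToHom_map]⟩

/-- Morphisms of Lawvere theories preserve all finite products. -/
theorem Hom.preservesFiniteProducts {L L' : LawvereTheory.{u}} (F : L ⟶ L') :
    PreservesFiniteProducts (Hom.toFunctor F) := by
  refine preservesFiniteProducts_of_powers L.π _ L.pow_bijective.2 L.isPower fun n => ?_
  have h := (fan_isLimit_iff _ _).1 (L'.isPower n)
  refine (fan_isLimit_iff _ _).2 fun Z => ?_
  let e₁ : (Z ⟶ (Hom.toFunctor F).obj (L.pow n)) ≃ (Z ⟶ L'.pow n) :=
    (Iso.refl Z).homCongr (eqToIso (Hom.obj_pow F n))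
  let e₂ : (Fin n → (Z ⟶ L'.pow 1)) ≃ (Fin n → (Z ⟶ (Hom.toFunctor F).obj (L.pow 1))) :=
    Equiv.piCongrRight fun _ => (Iso.refl Z).homCongr (eqToIso (Hom.obj_pow F 1).symm)
  convert e₂.bijective.comp ((h Z).comp e₁.bijective) using 1
  funext g i
  simp [e₁, e₂, Hom.map_π]

/-- A functor from a Lawvere theory to sets is a model if it preserves finite products. -/
def isModel (L : LawvereTheory.{u}) : ObjectProperty (L.Obj ⥤ Type u) :=
  fun F => PreservesFiniteProducts F

/-- The category of models of a Lawvere theory, with all natural transformations as morphisms. -/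
abbrev Model (L : LawvereTheory.{u}) : Type (u + 1) := L.isModel.FullSubcategory

/-- Restriction of models along a morphism of Lawvere theories. -/
def Model.restrict {L L' : LawvereTheory.{u}} (F : L ⟶ L') : L'.Model ⥤ L.Model where
  obj M := ⟨Hom.toFunctor F ⋙ M.obj, by
    have := Hom.preservesFiniteProducts F
    have : PreservesFiniteProducts M.obj := M.property
    exact comp_preservesFiniteProducts _ _⟩
  map α := ⟨Functor.whiskerLeft (Hom.toFunctor F) α.hom⟩

/-- The functor `Mod`, sending a Lawvere theory to its category of models and a morphism of
theories `L ⟶ L'` to the restriction functor `Mod L' ⥤ Mod L`. -/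
def models : LawvereTheory.{u}ᵒᵖ ⥤ Cat.{u, u + 1} where
  obj L := Cat.of L.unop.Model
  map F := (Model.restrict F.unop).toCatHom
  map_id _ := rfl
  map_comp _ _ := rfl

end LawvereTheory

/-! ### Categories enriched in `[𝓕, Set]` -/

/-- An `[𝓕, Set]`-category, where `𝓕` is the category of finite cardinals and `[𝓕, Set]` carries
the substitution (composition) monoidal structure, written out explicitly. -/
structure FSetCat where
  /-- The objects. -/
  Obj : Type v
  /-- The value at the cardinal `n` of the hom-object from `X` to `Y`. -/
  Hom (X Y : Obj) (n : ℕ) : Type u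
  /-- The functoriality of the hom-objects. -/
  reindex {X Y : Obj} {n m : ℕ} (φ : Fin n → Fin m) : Hom X Y n → Hom X Y m
  /-- The identities. -/
  one (X : Obj) : Hom X X 1
  /-- The composite `g ∘ (f₁, …, fₘ)`. -/
  comp {X Y Z : Obj} {m n : ℕ} (g : Hom Y Z m) (f : Fin m → Hom X Y n) : Hom X Z n
  reindex_id {X Y : Obj} {n : ℕ} (f : Hom X Y n) : reindex id f = f
  reindex_reindex {X Y : Obj} {n m k : ℕ} (φ : Fin n → Fin m) (ψ : Fin m → Fin k)
    (f : Hom X Y n) : reindex ψ (reindex φ f) = reindex (ψ ∘ φ) f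
  reindex_comp {X Y Z : Obj} {m n k : ℕ} (φ : Fin n → Fin k) (g : Hom Y Z m)
    (f : Fin m → Hom X Y n) : reindex φ (comp g f) = comp g (fun i => reindex φ (f i))
  comp_reindex {X Y Z : Obj} {m n k : ℕ} (φ : Fin m → Fin k) (g : Hom Y Z m)
    (f : Fin k → Hom X Y n) : comp (reindex φ g) f = comp g (fun i => f (φ i))
  proj_comp {X Y : Obj} {m n : ℕ} (i : Fin m) (f : Fin m → Hom X Y n) :
    comp (reindex (fun _ => i) (one Y)) f = f i
  comp_proj {X Y : Obj} {m : ℕ} (g : Hom X Y m) :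
    comp g (fun i => reindex (fun _ => i) (one X)) = g
  assoc {W X Y Z : Obj} {j k n : ℕ} (h : Hom Y Z j) (g : Fin j → Hom X Y k)
    (f : Fin k → Hom W X n) : comp h (fun i => comp (g i) f) = comp (comp h g) f

/-- An `[𝓕, Set]`-functor. -/
structure FSetFunctor (M N : FSetCat.{u, v}) where
  /-- The action on objects. -/
  obj : M.Obj → N.Obj
  /-- The action on hom-objects. -/
  map {X Y : M.Obj} {n : ℕ} : M.Hom X Y n → N.Hom (obj X) (obj Y) n
  map_reindex {X Y : M.Obj} {n m : ℕ} (φ : Fin n → Fin m) (f : M.Hom X Y n) :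
    map (M.reindex φ f) = N.reindex φ (map f)
  map_one (X : M.Obj) : map (M.one X) = N.one (obj X)
  map_comp {X Y Z : M.Obj} {m n : ℕ} (g : M.Hom Y Z m) (f : Fin m → M.Hom X Y n) :
    map (M.comp g f) = N.comp (map g) (fun i => map (f i))

namespace FSetCat

variable (M : FSetCat.{u, v})

/-- The `i`-th projection `πᵢ`, of arity `n`. -/
def proj (X : M.Obj) {n : ℕ} (i : Fin n) : M.Hom X X n := M.reindex (fun _ => i) (M.one X)

/-- The objects of the underlying ordinary category. -/
structure Underlying where
  /-- The object itself. -/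
  obj : M.Obj

/-- The underlying ordinary category of an `[𝓕, Set]`-category, with morphisms the unary ones. -/
instance : Category.{u} M.Underlying where
  Hom X Y := M.Hom X.obj Y.obj 1
  id X := M.one X.obj
  comp f g := M.comp g (fun _ => f)
  id_comp {X Y} f := by
    have h := M.comp_proj f
    have e : ∀ i : Fin 1, M.reindex (fun _ => i) (M.one X.obj) = M.one X.obj := fun i => by
      rw [show (fun _ : Fin 1 => i) = id from funext fun j => Subsingleton.elim _ _, M.reindex_id]
    simpa only [e] using h
  comp_id {X Y} f := by
    have h := M.proj_comp (0 : Fin 1) (fun _ => f)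
    rwa [show (fun _ : Fin 1 => (0 : Fin 1)) = id from
      funext fun j => Subsingleton.elim _ _, M.reindex_id] at h
  assoc f g h := M.assoc h (fun _ => g) (fun _ => f)

/-- The functor between underlying ordinary categories. -/
def _root_.MonadTheory.FSetFunctor.underlying {M N : FSetCat.{u, v}} (F : FSetFunctor M N) :
    M.Underlying ⥤ N.Underlying where
  obj X := ⟨F.obj X.obj⟩
  map f := F.map f
  map_id X := F.map_one X.obj
  map_comp f g := F.map_comp g (fun _ => f)

/-- The object `X ^ (n)` of the representable completion: the formal tensor of `X` by the
representable `yₙ = 𝓕(n, -)`. -/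
structure FormalTensor where
  /-- The object being tensored. -/
  base : M.Obj
  /-- The exponent `n`. -/
  exp : ℕ

/-- The action of a map `φ` on the second coordinate, `a × n → a × m`. -/
def timesMap (a : ℕ) {n m : ℕ} (φ : Fin n → Fin m) (s : Fin (a * n)) : Fin (a * m) :=
  finProdFinEquiv ((finProdFinEquiv.symm s).1, φ (finProdFinEquiv.symm s).2)

/-- The representable completion `L M` of an `[𝓕, Set]`-category: its objects are the formal tensors
`X ^ (n)` and its homs are `(L M)ₖ(X ^ (n), Y ^ (m)) = Mₙₖ(X, Y) ^ m`. -/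
def completion : FSetCat.{u, v} where
  Obj := M.FormalTensor
  Hom X Y k := Fin Y.exp → M.Hom X.base Y.base (X.exp * k)
  reindex {X _ _ _} φ f := fun i => M.reindex (timesMap X.exp φ) (f i)
  one X := fun i => M.proj X.base (finProdFinEquiv (i, 0))
  comp g f := fun i =>
    M.comp (g i) (fun s => f (finProdFinEquiv.symm s).2 (finProdFinEquiv.symm s).1)
  reindex_id f := by
    funext i
    rw [show ∀ a n : ℕ, timesMap a (id : Fin n → Fin n) = id from fun a n => by
      funext s; simp only [timesMap, id, Prod.mk.eta, Equiv.apply_symm_apply], M.reindex_id]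
  reindex_reindex φ ψ f := by
    funext i
    rw [M.reindex_reindex]
    congr 1
    funext s
    simp only [timesMap, Function.comp, Equiv.symm_apply_apply]
  reindex_comp φ g f := by
    funext i
    rw [M.reindex_comp]
  comp_reindex φ g f := by
    funext i
    rw [M.comp_reindex]
    simp only [timesMap, Equiv.symm_apply_apply]
  proj_comp i f := by
    funext j
    simp only [proj, M.reindex_reindex, Function.comp_def, M.proj_comp]
    simp only [timesMap, Equiv.symm_apply_apply]
  comp_proj g := by
    funext j
    simp only [proj, M.reindex_reindex, Function.comp_def]
    convert M.comp_proj (g j) using 5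
    simp only [timesMap, Equiv.symm_apply_apply, Prod.mk.eta, Equiv.apply_symm_apply]
  assoc h g f := by
    funext i
    rw [← M.assoc]

/-- The action of the representable completion on `[𝓕, Set]`-functors. -/
def _root_.MonadTheory.FSetFunctor.completion {M N : FSetCat.{u, v}} (F : FSetFunctor M N) :
    FSetFunctor M.completion N.completion where
  obj X := ⟨F.obj X.base, X.exp⟩
  map f := fun i => F.map (f i)
  map_reindex φ f := funext fun i => F.map_reindex _ _
  map_one X := funext fun i => by
    simp [FSetCat.completion, proj, F.map_reindex, F.map_one]
  map_comp g f := funext fun i => F.map_comp _ _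

end FSetCat

/-! ### From finitary monads to Lawvere theories -/

section Suspension

variable (T : Monad (Type u))

/-- The Kleisli extension `T m → T n` of a map `m → T n`, for a monad `T` on sets. -/
def extend {X Y : Type u} (f : X → T.obj Y) (t : T.obj X) : T.obj Y :=
  T.μ.app Y (T.map (↾f) t)

theorem extend_η {X Y : Type u} (f : X → T.obj Y) (x : X) : extend T f (T.η.app X x) = f x := by
  have h₁ := ConcreteCategory.congr_hom (T.η.naturality (↾f)) x
  have h₂ := ConcreteCategory.congr_hom (T.left_unit Y) (f x)
  simp only [types_comp_apply, Functor.id_map, types_id_apply, TypeCat.ofHom_apply] at h₁ h₂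
  rw [extend, ← h₁]
  exact h₂

theorem extend_id {X : Type u} (t : T.obj X) : extend T (fun x => T.η.app X x) t = t :=
  ConcreteCategory.congr_hom (T.right_unit X) t

theorem map_eq_extend {X Y : Type u} (f : X → Y) (t : T.obj X) :
    T.map (↾f) t = extend T (fun x => T.η.app Y (f x)) t := by
  have h := ConcreteCategory.congr_hom (T.right_unit Y) (T.map (↾f) t)
  simp only [types_comp_apply, types_id_apply] at h
  rw [extend, show (↾fun x => T.η.app Y (f x)) = ↾f ≫ T.η.app Y from rfl, T.map_comp]
  exact h.symm

theorem extend_extend {X Y Z : Type u} (f : X → T.obj Y) (g : Y → T.obj Z) (t : T.obj X) :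
    extend T g (extend T f t) = extend T (fun x => extend T g (f x)) t := by
  have h₁ := ConcreteCategory.congr_hom (T.μ.naturality (↾g)) (T.map (↾f) t)
  have h₂ := ConcreteCategory.congr_hom (T.assoc Z) (T.map (T.map (↾g)) (T.map (↾f) t))
  simp only [types_comp_apply] at h₁ h₂
  rw [extend, extend, extend,
    show (↾fun x => extend T g (f x)) = ↾f ≫ T.map (↾g) ≫ T.μ.app Z from rfl,
    T.map_comp, T.map_comp]
  refine Eq.trans (congrArg _ h₁.symm) h₂.symm

/-- The one-object `[𝓕, Set]`-category `ΣT` of a monad `T` on sets: its `n`-ary morphisms are the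
elements of `T n`, and its composition is that of the monad. -/
def suspension : FSetCat.{u, u} where
  Obj := PUnit
  Hom _ _ n := T.obj (ULift (Fin n))
  reindex φ t := T.map (↾fun s : ULift _ => ULift.up (φ s.down)) t
  one _ := T.η.app (ULift (Fin 1)) ⟨0⟩
  comp g f := extend T (fun s => f s.down) g
  reindex_id t := by
    rw [map_eq_extend]
    exact extend_id T t
  reindex_reindex φ ψ t := by
    simp only [map_eq_extend, extend_extend, extend_η, Function.comp]
  reindex_comp φ g f := by
    simp only [map_eq_extend, extend_extend]
  comp_reindex φ g f := by
    simp only [map_eq_extend, extend_extend, extend_η]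
  proj_comp i f := by
    simp only [map_eq_extend, extend_η]
  comp_proj g := by
    simp only [map_eq_extend, extend_η]
    exact extend_id T g
  assoc h g f := by
    simp only [extend_extend]

variable {T}

/-- The action of `Σ` on monad morphisms. -/
def suspensionMap {S : Monad (Type u)} (α : S ⟶ T) :
    FSetFunctor (suspension S) (suspension T) where
  obj X := X
  map {_ _ n} t := α.app (ULift (Fin n)) t
  map_reindex φ t := ConcreteCategory.congr_hom (α.naturality _) t
  map_one _ := ConcreteCategory.congr_hom (α.app_η _) _
  map_comp {_ _ _ m n} g f := by
    have h := ConcreteCategory.congr_hom (α.app_μ (ULift (Fin n)))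
      (S.map (↾fun s : ULift (Fin m) => f s.down) g)
    refine h.trans (congrArg (fun t => T.μ.app (ULift (Fin n)) t) ?_)
    have h' := ConcreteCategory.congr_hom
      (α.naturality ((↾fun s : ULift (Fin m) => f s.down) ≫ α.app (ULift (Fin n)))) g
    have e := ConcreteCategory.congr_hom
      (S.map_comp (↾fun s : ULift (Fin m) => f s.down) (α.app (ULift (Fin n)))) g
    exact (congrArg (fun t => α.app (T.obj (ULift (Fin n))) t) e.symm).trans h'

end Suspension

/-- The Lawvere theory of a monad `T`: the underlying category of the representable completion
`L(ΣT)` of `ΣT`, with distinguished object `X ^ (1)`, where `X` is the unique object of `ΣT`. -/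
def theory (T : Monad (Type u)) : LawvereTheory.{u} where
  Obj := (suspension T).completion.Underlying
  pow n := ⟨⟨PUnit.unit, n⟩⟩
  pow_bijective := ⟨fun m n h => congrArg (fun X => X.obj.exp) h, fun X => ⟨X.obj.exp, rfl⟩⟩
  π n i := fun _ => (suspension T).proj PUnit.unit (finProdFinEquiv (i, 0))
  isPower n := by
    refine (fan_isLimit_iff _ _).2 fun Z => ?_
    have key : ∀ (g : Z ⟶ (⟨⟨PUnit.unit, n⟩⟩ : (suspension T).completion.Underlying)) (i : Fin n),
        (suspension T).completion.comp (X := Z.obj) (Y := ⟨PUnit.unit, n⟩) (Z := ⟨PUnit.unit, 1⟩)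
          (fun _ => (suspension T).proj PUnit.unit (finProdFinEquiv (i, (0 : Fin 1))))
          (fun _ => g) = fun _ => g i := by
      intro g i
      funext j
      refine ((suspension T).proj_comp (X := Z.obj.base) (finProdFinEquiv (i, (0 : Fin 1)))
        (fun s => g (finProdFinEquiv.symm s).1)).trans ?_
      simp only [Equiv.symm_apply_apply]
    refine ⟨fun g g' h => ?_, fun k => ⟨fun i => k i 0, ?_⟩⟩
    · funext i
      have h' := congrFun h i
      exact congrFun ((key g i).symm.trans (h'.trans (key g' i))) 0
    · funext i
      refine (key _ i).trans ?_
      funext j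
      rw [Subsingleton.elim j 0]
  π_one := by
    funext j
    rw [Subsingleton.elim j 0]
    rfl

/-- The functor sending a finitary monad `T` to its Lawvere theory `L(ΣT)`. -/
def theoryFunctor : FinitaryMonad.{u} ⥤ LawvereTheory.{u} where
  obj T := theory T.obj
  map {S T} α := ⟨(suspensionMap α.hom).completion.underlying, fun _ => rfl, fun n i => by
    refine Eq.trans ?_
      ((Category.id_comp _).trans (Category.comp_id ((theory T.obj).π n i))).symm
    funext j
    refine ((suspensionMap α.hom).map_reindex
      (fun _ => finProdFinEquiv (i, (0 : Fin 1))) ((suspension S.obj).one PUnit.unit)).trans ?_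
    exact congrArg _ ((suspensionMap α.hom).map_one PUnit.unit)⟩
  map_id T := rfl
  map_comp α β := rfl

end MonadTheory

/-!
A finitary monad `T` and a Lawvere theory `L` both determine a clone of operations, with `n`-ary
operations `T n` and `X ^ n ⟶ X` respectively, and the clone of `L(ΣT)` is that of `T`. Passing to
the clone is an equivalence from finitary monads, because every element of `T X` has the form
`θ(x₁, …, xₙ)` with `θ ∈ T n`, and it is fully faithful on Lawvere theories, because a morphism into
`X ^ n` is a tuple of operations. Hence `T ↦ L(ΣT)` is an equivalence.

An algebra `A` for `T` gives the model `X ^ n ↦ A ^ n` of `L(ΣT)`. Conversely, the value `A` of a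
model at `X` carries a morphism from the clone of `T` to the clone `A ^ n → A` of all operations on
`A`, which is the clone of the continuation monad `X ↦ ((X → A) → A)`. Since `T` is finitary, it
extends to a monad morphism from `T` to the continuation monad, that is, to a `T`-algebra on `A`.
-/

namespace MonadTheory

/-! ### Finitary functors on the category of sets -/

theorem exists_finite_retract {X J : Type*} [Finite J] (x : J → X) :
    ∃ (p : ℕ) (i : Fin p → X) (r : X → Fin p), ∀ j, i (r (x j)) = x j := by
  rcases isEmpty_or_nonempty X with _ | ⟨⟨x₀⟩⟩
  · exact ⟨0, Fin.elim0, isEmptyElim, fun j => isEmptyElim (x j)⟩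
  · obtain ⟨p, ⟨e⟩⟩ := Finite.exists_equiv_fin (Option J)
    have : Nonempty (Fin p) := ⟨e none⟩
    let i : Fin p → X := fun a => (e.symm a).elim x₀ x
    exact ⟨p, i, Function.invFun i, fun j => Function.invFun_eq ⟨e (some j), by simp [i]⟩⟩

section Instantiation

variable (F : Type u ⥤ Type v)

/-- The element `θ(x₁, …, xₙ)` of `F X`, for an element `θ` of `F n` regarded as a formal `n`-ary
operation. -/
def instantiate {n : ℕ} {X : Type u} (θ : F.obj (ULift (Fin n))) (x : Fin n → X) : F.obj X :=
  F.map (↾fun s : ULift (Fin n) => x s.down) θ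

/-- The renaming of the variables of a formal operation. -/
def rename {m n : ℕ} (ρ : Fin m → Fin n) (θ : F.obj (ULift (Fin m))) : F.obj (ULift (Fin n)) :=
  instantiate F θ (fun i => ULift.up (ρ i))

theorem map_instantiate {n : ℕ} {X Y : Type u} (f : X ⟶ Y) (θ : F.obj (ULift (Fin n)))
    (x : Fin n → X) : F.map f (instantiate F θ x) = instantiate F θ (fun i => f (x i)) :=
  (ConcreteCategory.congr_hom (F.map_comp _ f) θ).symm

theorem instantiate_rename {m n : ℕ} {X : Type u} (ρ : Fin m → Fin n) (θ : F.obj (ULift (Fin m)))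
    (x : Fin n → X) : instantiate F (rename F ρ θ) x = instantiate F θ (fun i => x (ρ i)) :=
  map_instantiate F _ θ _

theorem instantiate_up {n : ℕ} (θ : F.obj (ULift (Fin n))) : instantiate F θ ULift.up = θ :=
  ConcreteCategory.congr_hom (F.map_id _) θ

theorem app_instantiate {F G : Type u ⥤ Type v} (α : F ⟶ G) {n : ℕ} {X : Type u}
    (θ : F.obj (ULift (Fin n))) (x : Fin n → X) :
    α.app X (instantiate F θ x) = instantiate G (α.app _ θ) x :=
  ConcreteCategory.congr_hom (α.naturality _) θ

/-- A functor on sets is finitely supported if every element of a value `F X` involves only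
finitely many elements of `X`. For endofunctors this is an elementwise form of finitariness, see
`preservesFilteredColimits_iff_isFinitelySupported`. -/
def IsFinitelySupported : Prop :=
  ∀ ⦃X : Type u⦄ (t : F.obj X), ∃ (n : ℕ) (θ : F.obj (ULift (Fin n))) (x : Fin n → X),
    instantiate F θ x = t

end Instantiation

namespace IsFinitelySupported

theorem exists_common_instantiate {F : Type u ⥤ Type v} (hF : IsFinitelySupported F) {J : Type*}
    [Finite J] {X : Type u} (t : J → F.obj X) :
    ∃ (p : ℕ) (θ : J → F.obj (ULift (Fin p))) (x : Fin p → X),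
      ∀ j, instantiate F (θ j) x = t j := by
  choose n θ x h using fun j => hF (t j)
  obtain ⟨p, i, r, hr⟩ := exists_finite_retract fun a : Σ j, Fin (n j) => x a.1 a.2
  refine ⟨p, fun j => rename F (fun a => r (x j a)) (θ j), i, fun j => ?_⟩
  rw [instantiate_rename, ← h j]
  exact congrArg _ (funext fun a => hr ⟨j, a⟩)

/-- The elements of `F X` involve finitely many elements of `X`, and two of them that become equal
in the colimit are already identified by a map from `X` to a finite cardinal. -/
theorem preservesFilteredColimits {F : Type u ⥤ Type u} (hF : IsFinitelySupported F) :
    PreservesFilteredColimits F := by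
  refine ⟨fun J _ _ => ⟨fun {D} => ⟨fun {c} hc => ⟨?_⟩⟩⟩⟩
  have := Cardinal.fact_isRegular_aleph0
  have finitelyPresentable (n : ℕ) : IsFinitelyPresentable.{u} (ULift.{u} (Fin n)) :=
    HasCardinalLT.isCardinalPresentable (hasCardinalLT_of_finite _ _ le_rfl)
  refine Types.FilteredColimit.isColimitOf' _ _ (fun t => ?_) (fun j t t' h => ?_)
  · obtain ⟨n, θ, x, rfl⟩ := hF t
    obtain ⟨j, y, hy⟩ := IsFinitelyPresentable.exists_hom_of_isColimit hc
      (↾fun s : ULift (Fin n) => x s.down)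
    exact ⟨j, F.map y θ, by rw [instantiate, ← hy, F.map_comp]; rfl⟩
  · obtain ⟨n, θ, z, hz⟩ := hF.exists_common_instantiate ![t, t']
    obtain rfl : instantiate F (θ 0) z = t := hz 0
    obtain rfl : instantiate F (θ 1) z = t' := hz 1
    obtain ⟨p, i, r, hr⟩ := exists_finite_retract fun a => c.ι.app j (z a)
    have rename_eq : rename F (fun a => r (c.ι.app j (z a))) (θ 0) =
        rename F (fun a => r (c.ι.app j (z a))) (θ 1) := by
      have h' := congrArg (F.map (↾fun b => ULift.up (r b))) h
      simp only [Functor.mapCocone_ι_app, map_instantiate] at h'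
      exact h'
    obtain ⟨k, y, hy⟩ := IsFinitelyPresentable.exists_hom_of_isColimit hc
      (↾fun s : ULift (Fin p) => i s.down)
    obtain ⟨l, g, f, e⟩ := IsFinitelyPresentable.exists_eq_of_isColimit hc
      (↾fun s : ULift (Fin n) => z s.down)
      ((↾fun s : ULift (Fin n) => ULift.up (r (c.ι.app j (z s.down)))) ≫ y) (by
        rw [Category.assoc, hy]
        exact ConcreteCategory.hom_ext _ _ fun s => (hr s.down).symm)
    have factor (ω : F.obj (ULift (Fin n))) : F.map (D.map g) (instantiate F ω z) =
        instantiate F (rename F (fun a => r (c.ι.app j (z a))) ω) (fun b => D.map f (y ⟨b⟩)) := by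
      rw [map_instantiate, instantiate_rename]
      exact congrArg _ (funext fun a => ConcreteCategory.congr_hom e ⟨a⟩)
    exact ⟨l, g, (factor _).trans ((congrArg (instantiate F · _) rename_eq).trans (factor _).symm)⟩

end IsFinitelySupported

theorem preservesFilteredColimits_iff_isFinitelySupported (F : Type u ⥤ Type u) :
    PreservesFilteredColimits F ↔ IsFinitelySupported F := by
  refine ⟨fun _ X t => ?_, fun hF => hF.preservesFilteredColimits⟩
  have := HasCardinalLT.Set.isFiltered_of_aleph0_le X Cardinal.aleph0 le_rfl
  obtain ⟨⟨A, hA⟩, θ, rfl⟩ := Types.jointly_surjective_of_isColimit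
    (isColimitOfPreserves F (HasCardinalLT.Set.isColimitCocone X Cardinal.aleph0 le_rfl)) t
  have : Finite A := (hasCardinalLT_aleph0_iff _).1 hA
  obtain ⟨n, ⟨e⟩⟩ := Finite.exists_equiv_fin A
  refine ⟨n, F.map (↾fun a : A => ULift.up (e a)) θ, fun i => (e.symm i).1, ?_⟩
  refine (ConcreteCategory.congr_hom (F.map_comp _ _) θ).symm.trans ?_
  exact congrArg (fun f => F.map f θ) (ConcreteCategory.hom_ext _ _ fun a =>
    congrArg Subtype.val (e.symm_apply_apply a))

section Extension

variable {F G : Type u ⥤ Type v}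

theorem natTrans_ext_of_isFinitelySupported (hF : IsFinitelySupported F) {α β : F ⟶ G}
    (h : ∀ (n : ℕ) (θ : F.obj (ULift (Fin n))), α.app _ θ = β.app _ θ) : α = β := by
  refine NatTrans.ext (funext fun X => ConcreteCategory.hom_ext _ _ fun t => ?_)
  obtain ⟨n, θ, x, rfl⟩ := hF t
  rw [app_instantiate, app_instantiate, h]

/-- `F X` is the coend of `F n × Xⁿ` over `n`, so maps out of it are determined by maps that are
compatible with renaming. -/
theorem exists_natTrans_extending (hF : IsFinitelySupported F)
    (φ : ∀ n : ℕ, F.obj (ULift (Fin n)) → G.obj (ULift (Fin n)))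
    (φ_rename : ∀ {m n : ℕ} (ρ : Fin m → Fin n) (θ : F.obj (ULift (Fin m))),
      φ n (rename F ρ θ) = rename G ρ (φ m θ)) :
    ∃ α : F ⟶ G, ∀ (n : ℕ) (θ : F.obj (ULift (Fin n))), α.app _ θ = φ n θ := by
  have well_defined {X : Type u} {m n : ℕ} {θ : F.obj (ULift (Fin m))}
      {θ' : F.obj (ULift (Fin n))} {x : Fin m → X} {x' : Fin n → X}
      (h : instantiate F θ x = instantiate F θ' x') :
      instantiate G (φ m θ) x = instantiate G (φ n θ') x' := by
    obtain ⟨p, i, r, hr⟩ := exists_finite_retract (Sum.elim x x')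
    have rename_eq : rename F (fun a => r (x a)) θ = rename F (fun a => r (x' a)) θ' := by
      have h' := congrArg (F.map (↾fun a => ULift.up (r a))) h
      simp only [map_instantiate] at h'
      exact h'
    have h' := congrArg (fun ω => instantiate G (φ p ω) i) rename_eq
    simp only [φ_rename, instantiate_rename] at h'
    convert h' using 2
    exacts [funext fun a => (hr (Sum.inl a)).symm, funext fun a => (hr (Sum.inr a)).symm]
  choose n θ x h using hF
  refine ⟨⟨fun X => ↾fun t => instantiate G (φ _ (θ t)) (x t), fun X Y f => ?_⟩, fun n ω => ?_⟩
  · ext t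
    refine (well_defined ?_).trans (map_instantiate G f _ _).symm
    exact (h _).trans ((congrArg (F.map f) (h t).symm).trans (map_instantiate F f _ _))
  · refine (well_defined (x' := ULift.up) ?_).trans (instantiate_up G _)
    rw [h, instantiate_up]

end Extension

/-! ### Clones -/

/-- An abstract clone: a family of sets of `n`-ary operations with variables and simultaneous
substitution. Clones mediate between finitary monads and Lawvere theories. -/
structure Clone where
  /-- The `n`-ary operations. -/
  Op : ℕ → Type u
  /-- The variables. -/
  var {n : ℕ} (i : Fin n) : Op n
  /-- Simultaneous substitution. -/
  subst {m n : ℕ} (θ : Op m) (σ : Fin m → Op n) : Op n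
  var_subst {m n : ℕ} (i : Fin m) (σ : Fin m → Op n) : subst (var i) σ = σ i
  subst_var {n : ℕ} (θ : Op n) : subst θ var = θ
  subst_subst {l m n : ℕ} (θ : Op l) (σ : Fin l → Op m) (τ : Fin m → Op n) :
    subst (subst θ σ) τ = subst θ (fun i => subst (σ i) τ)

namespace Clone

/-- A morphism of clones. -/
@[ext]
structure Hom (C D : Clone.{u}) where
  /-- The action on the operations of a given arity. -/
  app (n : ℕ) : C.Op n → D.Op n
  app_var {n : ℕ} (i : Fin n) : app n (C.var i) = D.var i
  app_subst {m n : ℕ} (θ : C.Op m) (σ : Fin m → C.Op n) :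
    app n (C.subst θ σ) = D.subst (app m θ) (fun i => app n (σ i))

instance : Category Clone.{u} where
  Hom := Hom
  id C := ⟨fun _ θ => θ, fun _ => rfl, fun _ _ => rfl⟩
  comp f g := ⟨fun n θ => g.app n (f.app n θ), fun i => by rw [f.app_var, g.app_var],
    fun θ σ => by rw [f.app_subst, g.app_subst]⟩

theorem hom_ext {C D : Clone.{u}} {f g : C ⟶ D}
    (h : ∀ (n : ℕ) (θ : C.Op n), Hom.app f n θ = Hom.app g n θ) : f = g :=
  Hom.ext (funext fun n => funext fun θ => h n θ)

/-- A morphism of clones that is bijective on operations, as an isomorphism. -/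
def isoOfEquiv {C D : Clone.{u}} (e : ∀ n, C.Op n ≃ D.Op n)
    (e_var : ∀ {n : ℕ} (i : Fin n), e n (C.var i) = D.var i)
    (e_subst : ∀ {m n : ℕ} (θ : C.Op m) (σ : Fin m → C.Op n),
      e n (C.subst θ σ) = D.subst (e m θ) (fun i => e n (σ i))) : C ≅ D where
  hom := ⟨fun n => e n, e_var, e_subst⟩
  inv := ⟨fun n => (e n).symm, fun i => by rw [← e_var, Equiv.symm_apply_apply],
    fun θ σ => by rw [Equiv.symm_apply_eq, e_subst]; simp only [Equiv.apply_symm_apply]⟩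
  hom_inv_id := hom_ext fun n => (e n).symm_apply_apply
  inv_hom_id := hom_ext fun n => (e n).apply_symm_apply

end Clone

/-! ### The clone of a monad -/

section Extend

variable (T : Monad (Type u))

theorem extend_self {X : Type u} (t : T.obj (T.obj X)) :
    extend T (fun s : T.obj X => s) t = T.μ.app X t :=
  congrArg (T.μ.app X) (ConcreteCategory.congr_hom (T.map_id (T.obj X)) t)

theorem instantiate_eq_extend {n : ℕ} {X : Type u} (θ : T.obj (ULift (Fin n))) (x : Fin n → X) :
    instantiate T.toFunctor θ x = extend T (fun s => T.η.app X (x s.down)) θ :=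
  map_eq_extend T _ θ

theorem extend_instantiate {n : ℕ} {X Y : Type u} (f : X → T.obj Y) (θ : T.obj (ULift (Fin n)))
    (x : Fin n → X) :
    extend T f (instantiate T.toFunctor θ x) = extend T (fun s => f (x s.down)) θ := by
  simp only [instantiate_eq_extend, extend_extend, extend_η]

theorem instantiate_extend {m n : ℕ} {X : Type u} (θ : T.obj (ULift (Fin m)))
    (σ : Fin m → T.obj (ULift (Fin n))) (x : Fin n → X) :
    instantiate T.toFunctor (extend T (fun s => σ s.down) θ) x =
      extend T (fun s => instantiate T.toFunctor (σ s.down) x) θ := by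
  simp only [instantiate_eq_extend, extend_extend]

theorem instantiate_η {n : ℕ} {X : Type u} (i : Fin n) (x : Fin n → X) :
    instantiate T.toFunctor (T.η.app (ULift (Fin n)) ⟨i⟩) x = T.η.app X (x i) := by
  rw [instantiate_eq_extend, extend_η]

variable {T}

theorem app_extend {S : Monad (Type u)} (α : S ⟶ T) {X Y : Type u} (f : X → S.obj Y)
    (t : S.obj X) :
    α.app Y (extend S f t) = extend T (fun x => α.app Y (f x)) (α.app X t) := by
  have μ_app := ConcreteCategory.congr_hom (α.app_μ Y) (S.map (↾f) t)
  have naturality := ConcreteCategory.congr_hom (α.naturality (↾f ≫ α.app Y)) t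
  have map_comp := ConcreteCategory.congr_hom (S.map_comp (↾f) (α.app Y)) t
  exact μ_app.trans (congrArg (T.μ.app Y)
    ((congrArg (α.app (T.obj Y)) map_comp.symm).trans naturality))

/-- A natural transformation of monads on sets that is compatible with the units and the Kleisli
extensions, as a morphism of monads. -/
def monadHomOfExtend {S : Monad (Type u)} (α : S.toFunctor ⟶ T.toFunctor)
    (α_η : ∀ {X : Type u} (x : X), α.app X (S.η.app X x) = T.η.app X x)
    (α_extend : ∀ {X Y : Type u} (f : X → S.obj Y) (t : S.obj X),
      α.app Y (extend S f t) = extend T (fun x => α.app Y (f x)) (α.app X t)) : S ⟶ T where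
  toNatTrans := α
  app_η _ := ConcreteCategory.hom_ext _ _ α_η
  app_μ X := ConcreteCategory.hom_ext _ _ fun t => by
    have h := α_extend (fun s : S.obj X => s) t
    rw [extend_self] at h
    exact h.trans (congrArg (T.μ.app X)
      (ConcreteCategory.congr_hom (α.naturality (α.app X)) t).symm)

end Extend

/-- The clone of a monad `T` on sets, whose `n`-ary operations are the elements of `T n`. -/
def monadClone : Monad (Type u) ⥤ Clone.{u} where
  obj T :=
    { Op n := T.obj (ULift (Fin n))
      var i := T.η.app _ ⟨i⟩
      subst θ σ := extend T (fun s => σ s.down) θ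
      var_subst _ _ := extend_η T _ _
      subst_var := extend_id T
      subst_subst _ _ _ := extend_extend T _ _ _ }
  map α :=
    { app n := α.app (ULift (Fin n))
      app_var _ := ConcreteCategory.congr_hom (α.app_η _) _
      app_subst _ _ := app_extend α _ _ }

theorem monadClone_subst_var (T : Monad (Type u)) {m n : ℕ} (ρ : Fin m → Fin n)
    (θ : (monadClone.obj T).Op m) :
    (monadClone.obj T).subst θ (fun i => (monadClone.obj T).var (ρ i)) =
      rename T.toFunctor ρ θ :=
  (instantiate_eq_extend T θ fun i => ULift.up (ρ i)).symm

/-! ### Finitary monads are determined by their clones -/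

section FullyFaithful

variable {S T : Monad (Type u)}

theorem monadHom_ext_of_isFinitelySupported (hS : IsFinitelySupported S.toFunctor)
    {α β : S ⟶ T} (h : monadClone.map α = monadClone.map β) : α = β := by
  have toNatTrans_eq : α.toNatTrans = β.toNatTrans :=
    natTrans_ext_of_isFinitelySupported hS fun n θ =>
      congrArg (fun φ : monadClone.obj S ⟶ monadClone.obj T => Clone.Hom.app φ n θ) h
  exact MonadHom.ext' _ _ (congrArg NatTrans.app toNatTrans_eq)

theorem exists_monadHom_extending (hS : IsFinitelySupported S.toFunctor)
    (φ : monadClone.obj S ⟶ monadClone.obj T) : ∃ α : S ⟶ T, monadClone.map α = φ := by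
  have φ_rename {m n : ℕ} (ρ : Fin m → Fin n) (θ : (monadClone.obj S).Op m) :
      φ.app n (rename S.toFunctor ρ θ) = rename T.toFunctor ρ (φ.app m θ) := by
    refine (congrArg (φ.app n) (monadClone_subst_var S ρ θ).symm).trans ?_
    rw [φ.app_subst]
    simp only [φ.app_var]
    exact monadClone_subst_var T ρ (φ.app m θ)
  obtain ⟨α, hα⟩ := exists_natTrans_extending (G := T.toFunctor) hS φ.app φ_rename
  have α_η {X : Type u} (x : X) : α.app X (S.η.app X x) = T.η.app X x := by
    rw [← instantiate_η S (0 : Fin 1) fun _ => x, app_instantiate, hα]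
    exact (congrArg (instantiate T.toFunctor · _) (φ.app_var 0)).trans (instantiate_η T 0 _)
  have α_extend {X Y : Type u} (f : X → S.obj Y) (t : S.obj X) :
      α.app Y (extend S f t) = extend T (fun x => α.app Y (f x)) (α.app X t) := by
    obtain ⟨m, θ, x, rfl⟩ := hS t
    obtain ⟨n, σ, y, hσ⟩ := hS.exists_common_instantiate fun i => f (x i)
    simp only [extend_instantiate, app_instantiate, ← hσ]
    rw [← instantiate_extend S θ σ, ← instantiate_extend T _ fun i => α.app _ (σ i),
      app_instantiate]
    simp only [hα]
    exact congrArg (instantiate T.toFunctor · y) (φ.app_subst θ σ)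
  exact ⟨monadHomOfExtend α α_η α_extend, Clone.hom_ext hα⟩

end FullyFaithful

/-- The functor sending a finitary monad to its clone. -/
abbrev finitaryMonadClone : FinitaryMonad.{u} ⥤ Clone.{u} := isFinitary.ι ⋙ monadClone

theorem isFinitary_iff_isFinitelySupported (T : Monad (Type u)) :
    isFinitary T ↔ IsFinitelySupported T.toFunctor :=
  preservesFilteredColimits_iff_isFinitelySupported _

instance : finitaryMonadClone.{u}.Faithful where
  map_injective {S _ _ _} h := ObjectProperty.hom_ext _
    (monadHom_ext_of_isFinitelySupported
      ((isFinitary_iff_isFinitelySupported _).1 S.property) h)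

instance : finitaryMonadClone.{u}.Full where
  map_surjective {S _} φ :=
    have ⟨α, hα⟩ := exists_monadHom_extending
      ((isFinitary_iff_isFinitelySupported _).1 S.property) φ
    ⟨ObjectProperty.homMk α, hα⟩

/-! ### Every clone is the clone of a finitary monad -/

namespace Clone

variable (C : Clone.{u})

/-- The terms of a clone with variables in `X`, encoded by the functions they induce on the free
algebras `C.Op k`. -/
def Term (X : Type u) : Type u :=
  {t : ∀ k, (X → C.Op k) → C.Op k //
    ∃ (n : ℕ) (θ : C.Op n) (x : Fin n → X), ∀ k σ, t k σ = C.subst θ (fun i => σ (x i))}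

namespace Term

variable {C}

/-- The term `θ(x₁, …, xₙ)`. -/
def mk {n : ℕ} {X : Type u} (θ : C.Op n) (x : Fin n → X) : Term C X :=
  ⟨fun _ σ => C.subst θ (fun i => σ (x i)), n, θ, x, fun _ _ => rfl⟩

theorem exists_mk {X : Type u} (t : Term C X) :
    ∃ (n : ℕ) (θ : C.Op n) (x : Fin n → X), mk θ x = t := by
  obtain ⟨t, n, θ, x, h⟩ := t
  exact ⟨n, θ, x, Subtype.ext (funext fun k => funext fun σ => (h k σ).symm)⟩

theorem exists_common_mk {X : Type u} {J : Type*} [Finite J] (t : J → Term C X) :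
    ∃ (p : ℕ) (θ : J → C.Op p) (x : Fin p → X), ∀ j, mk (θ j) x = t j := by
  choose n θ x h using fun j => exists_mk (t j)
  obtain ⟨p, i, r, hr⟩ := exists_finite_retract fun a : Σ j, Fin (n j) => x a.1 a.2
  refine ⟨p, fun j => C.subst (θ j) fun a => C.var (r (x j a)), i, fun j => ?_⟩
  refine (Subtype.ext (funext fun k => funext fun σ => ?_)).trans (h j)
  simp only [mk, C.subst_subst, C.var_subst, fun a => hr ⟨j, a⟩]

instance : _root_.Monad (Term C) where
  pure x := ⟨fun _ σ => σ x, 1, C.var 0, fun _ => x,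
    fun _ σ => (C.var_subst (0 : Fin 1) fun _ => σ x).symm⟩
  bind t f := ⟨fun k σ => t.1 k fun x => (f x).1 k σ, by
    obtain ⟨m, θ, x, rfl⟩ := exists_mk t
    obtain ⟨n, τ, y, h⟩ := exists_common_mk fun i => f (x i)
    refine ⟨n, C.subst θ τ, y, fun k σ => ?_⟩
    simp only [C.subst_subst, mk, ← h]⟩

instance : LawfulMonad (Term C) :=
  LawfulMonad.mk' _ (fun _ => rfl) (fun _ _ => rfl) (fun _ _ _ => rfl)

end Term

/-- The monad of terms of a clone. -/
def termMonad : Monad (Type u) := ofTypeMonad (Term C)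

theorem isFinitelySupported_termMonad : IsFinitelySupported C.termMonad.toFunctor := fun X t => by
  obtain ⟨n, θ, x, rfl⟩ := Term.exists_mk (show Term C X from t)
  exact ⟨n, Term.mk θ ULift.up, x, rfl⟩

/-- The clone of the term monad of a clone `C` is `C`. -/
def termMonadCloneIso : monadClone.obj C.termMonad ≅ C :=
  (isoOfEquiv (C := C) (D := monadClone.obj C.termMonad)
    (fun n =>
      { toFun θ := Term.mk θ ULift.up
        invFun t := t.1 n fun s => C.var s.down
        left_inv := C.subst_var
        right_inv t := by
          obtain ⟨m, θ, x, rfl⟩ := Term.exists_mk t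
          refine Subtype.ext (funext fun k => funext fun σ => ?_)
          simp only [Term.mk, C.subst_subst, C.var_subst] })
    (fun i => Subtype.ext (funext fun k => funext fun σ => C.var_subst i _))
    (fun θ σ => Subtype.ext (funext fun k => funext fun τ => C.subst_subst _ _ _))).symm

end Clone

instance : finitaryMonadClone.{u}.EssSurj where
  mem_essImage C := ⟨⟨C.termMonad, (isFinitary_iff_isFinitelySupported _).2
    C.isFinitelySupported_termMonad⟩, ⟨C.termMonadCloneIso⟩⟩

/-! ### The clone of a Lawvere theory -/

namespace LawvereTheory

section Clone

variable (L : LawvereTheory.{u})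

/-- The morphism into a power with given components. -/
noncomputable def lift {Z : L.Obj} {n : ℕ} (σ : Fin n → (Z ⟶ L.pow 1)) : Z ⟶ L.pow n :=
  Fan.IsLimit.lift (L.isPower n).some σ

@[simp]
theorem lift_π {Z : L.Obj} {n : ℕ} (σ : Fin n → (Z ⟶ L.pow 1)) (i : Fin n) :
    L.lift σ ≫ L.π n i = σ i :=
  Fan.IsLimit.fac (L.isPower n).some σ i

theorem hom_ext {Z : L.Obj} {n : ℕ} {f g : Z ⟶ L.pow n}
    (h : ∀ i, f ≫ L.π n i = g ≫ L.π n i) : f = g :=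
  Fan.IsLimit.hom_ext (L.isPower n).some _ _ h

theorem comp_lift {Y Z : L.Obj} {n : ℕ} (f : Y ⟶ Z) (σ : Fin n → (Z ⟶ L.pow 1)) :
    f ≫ L.lift σ = L.lift (fun i => f ≫ σ i) :=
  L.hom_ext fun i => by simp

theorem lift_comp_π {Z : L.Obj} {n : ℕ} (f : Z ⟶ L.pow n) : L.lift (fun i => f ≫ L.π n i) = f :=
  L.hom_ext fun i => by simp

theorem lift_fin_one {Z : L.Obj} (σ : Fin 1 → (Z ⟶ L.pow 1)) : L.lift σ = σ 0 := by
  rw [← L.lift_π σ 0, L.π_one, Category.comp_id]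

/-- The clone of a Lawvere theory, with `n`-ary operations the morphisms `X ^ n ⟶ X`. -/
noncomputable abbrev clone : Clone.{u} where
  Op n := L.pow n ⟶ L.pow 1
  var i := L.π _ i
  subst θ σ := L.lift σ ≫ θ
  var_subst i σ := L.lift_π σ i
  subst_var θ := by
    rw [show L.lift (L.π _) = 𝟙 _ from L.hom_ext fun i => by simp, Category.id_comp]
  subst_subst θ σ τ := by rw [← Category.assoc, L.comp_lift]

end Clone

namespace Hom

variable {L L' L'' : LawvereTheory.{u}}

/-- The action of a morphism of Lawvere theories on morphisms between powers. -/
def mapPow (F : L ⟶ L') {m n : ℕ} (f : L.pow m ⟶ L.pow n) : L'.pow m ⟶ L'.pow n :=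
  eqToHom (F.obj_pow m).symm ≫ F.toFunctor.map f ≫ eqToHom (F.obj_pow n)

theorem map_eq_mapPow (F : L ⟶ L') {m n : ℕ} (f : L.pow m ⟶ L.pow n) : F.toFunctor.map f =
    eqToHom (F.obj_pow m) ≫ mapPow F f ≫ eqToHom (F.obj_pow n).symm := by
  simp [mapPow]

theorem mapPow_comp (F : L ⟶ L') {l m n : ℕ} (f : L.pow l ⟶ L.pow m) (g : L.pow m ⟶ L.pow n) :
    mapPow F (f ≫ g) = mapPow F f ≫ mapPow F g := by
  simp [mapPow]

theorem mapPow_π (F : L ⟶ L') (n : ℕ) (i : Fin n) : mapPow F (L.π n i) = L'.π n i := by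
  simp [mapPow, F.map_π]

theorem mapPow_lift (F : L ⟶ L') {m n : ℕ} (σ : Fin n → (L.pow m ⟶ L.pow 1)) :
    mapPow F (L.lift σ) = L'.lift (fun i => mapPow F (σ i)) :=
  L'.hom_ext fun i => by rw [lift_π, ← mapPow_π F n i, ← mapPow_comp, lift_π]

theorem mapPow_id_hom {m n : ℕ} (f : L.pow m ⟶ L.pow n) : mapPow (𝟙 L) f = f :=
  (Category.id_comp _).trans (Category.comp_id _)

theorem mapPow_comp_hom (F : L ⟶ L') (G : L' ⟶ L'') {m n : ℕ} (f : L.pow m ⟶ L.pow n) :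
    mapPow (F ≫ G) f = mapPow G (mapPow F f) := by
  change eqToHom _ ≫ G.toFunctor.map (F.toFunctor.map f) ≫ eqToHom _ = _
  simp [mapPow, eqToHom_map]

theorem ext_mapPow {F G : L ⟶ L'}
    (h : ∀ (n : ℕ) (θ : L.pow n ⟶ L.pow 1), mapPow F θ = mapPow G θ) : F = G := by
  have mapPow_eq (m n : ℕ) (f : L.pow m ⟶ L.pow n) : mapPow F f = mapPow G f :=
    L'.hom_ext fun i => by
      rw [← mapPow_π F n i, ← mapPow_comp, h, mapPow_comp, mapPow_π, mapPow_π]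
  refine Hom.ext (CategoryTheory.Functor.ext (fun X => ?_) fun X Y f => ?_)
  · obtain ⟨n, rfl⟩ := L.pow_bijective.2 X
    exact (F.obj_pow n).trans (G.obj_pow n).symm
  · obtain ⟨m, rfl⟩ := L.pow_bijective.2 X
    obtain ⟨n, rfl⟩ := L.pow_bijective.2 Y
    rw [map_eq_mapPow F, map_eq_mapPow G, mapPow_eq]
    simp

end Hom

/-- The functor sending a Lawvere theory to its clone. -/
noncomputable def toClone : LawvereTheory.{u} ⥤ Clone.{u} where
  obj L := L.clone
  map {L L'} F :=
    { app _ θ := Hom.mapPow F θ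
      app_var i := Hom.mapPow_π F _ i
      app_subst θ σ := by rw [Hom.mapPow_comp, Hom.mapPow_lift] }
  map_id L := Clone.hom_ext fun _ θ => Hom.mapPow_id_hom θ
  map_comp F G := Clone.hom_ext fun _ θ => Hom.mapPow_comp_hom F G θ

instance : toClone.{u}.Faithful where
  map_injective {L L' _ _} h := Hom.ext_mapPow fun n θ =>
    congrArg (fun φ : L.clone ⟶ L'.clone => Clone.Hom.app φ n θ) h

section OfClone

variable {L L' : LawvereTheory.{u}} (φ : L.clone ⟶ L'.clone)

/-- The action of a morphism of clones on morphisms between powers. -/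
noncomputable def cloneMap {m n : ℕ} (f : L.pow m ⟶ L.pow n) : L'.pow m ⟶ L'.pow n :=
  L'.lift (fun i => φ.app m (f ≫ L.π n i))

theorem cloneMap_id (n : ℕ) : cloneMap φ (𝟙 (L.pow n)) = 𝟙 (L'.pow n) :=
  L'.hom_ext fun i => by
    rw [cloneMap, lift_π, Category.id_comp, Category.id_comp, φ.app_var]

theorem cloneMap_comp {l m n : ℕ} (f : L.pow l ⟶ L.pow m) (g : L.pow m ⟶ L.pow n) :
    cloneMap φ (f ≫ g) = cloneMap φ f ≫ cloneMap φ g :=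
  L'.hom_ext fun i => by
    have app_comp : φ.app l (L.lift (fun j => f ≫ L.π m j) ≫ g ≫ L.π n i) =
        L'.lift (fun j => φ.app l (f ≫ L.π m j)) ≫ φ.app m (g ≫ L.π n i) := φ.app_subst _ _
    rw [L.lift_comp_π] at app_comp
    simpa only [cloneMap, Category.assoc, lift_π] using app_comp

theorem cloneMap_fin_one {n : ℕ} (θ : L.pow n ⟶ L.pow 1) : cloneMap φ θ = φ.app n θ := by
  rw [cloneMap, lift_fin_one, L.π_one, Category.comp_id]

theorem cloneMap_eqToHom {m m' n n' : ℕ} (hm : m' = m) (hn : n = n') (f : L.pow m ⟶ L.pow n) :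
    cloneMap φ (eqToHom (congrArg L.pow hm) ≫ f ≫ eqToHom (congrArg L.pow hn)) =
      eqToHom (congrArg L'.pow hm) ≫ cloneMap φ f ≫ eqToHom (congrArg L'.pow hn) := by
  subst hm hn
  simp

/-- The exponent of an object of a Lawvere theory. -/
noncomputable def exponent (X : L.Obj) : ℕ := (Equiv.ofBijective _ L.pow_bijective).symm X

theorem pow_exponent (X : L.Obj) : L.pow (exponent X) = X :=
  (Equiv.ofBijective _ L.pow_bijective).apply_symm_apply X

theorem exponent_pow (n : ℕ) : exponent (L.pow n) = n :=
  (Equiv.ofBijective _ L.pow_bijective).symm_apply_apply n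

/-- The morphism of Lawvere theories induced by a morphism of clones. -/
noncomputable def homOfClone : L ⟶ L' where
  toFunctor :=
    { obj X := L'.pow (exponent X)
      map {X Y} f := cloneMap φ (eqToHom (pow_exponent X) ≫ f ≫ eqToHom (pow_exponent Y).symm)
      map_id X := by simp [cloneMap_id]
      map_comp f g := by rw [← cloneMap_comp]; simp }
  obj_pow n := congrArg L'.pow (exponent_pow n)
  map_π n i := (cloneMap_eqToHom φ (exponent_pow n) (exponent_pow 1).symm (L.π n i)).trans
    (by rw [cloneMap_fin_one, φ.app_var])

theorem mapPow_homOfClone {m n : ℕ} (f : L.pow m ⟶ L.pow n) :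
    Hom.mapPow (homOfClone φ) f = cloneMap φ f := by
  have map_eq := cloneMap_eqToHom φ (exponent_pow (L := L) m) (exponent_pow (L := L) n).symm f
  have cancel {X Y X' Y' : L'.Obj} (hX : X = X') (hY : Y' = Y) (g : X' ⟶ Y') :
      eqToHom hX.symm ≫ (eqToHom hX ≫ g ≫ eqToHom hY) ≫ eqToHom hY.symm = g := by simp
  exact (congrArg (fun g => eqToHom _ ≫ g ≫ eqToHom _) map_eq).trans (cancel _ _ _)

end OfClone

instance : toClone.{u}.Full where
  map_surjective φ := ⟨homOfClone φ, Clone.hom_ext fun _ θ =>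
    (mapPow_homOfClone φ θ).trans (cloneMap_fin_one φ θ)⟩

end LawvereTheory

/-! ### The Lawvere theory of a monad -/

section Components

variable {T : Monad (Type u)}

/-- The components of a morphism `X ^ m ⟶ X ^ n` of the Lawvere theory of `T`, as elements of `T m`.
By definition of the completion they are elements of `T (m * 1)`. -/
def components {m n : ℕ} :
    ((theory T).pow m ⟶ (theory T).pow n) ≃ (Fin n → T.obj (ULift (Fin m))) :=
  Equiv.piCongrRight fun _ => (T.toFunctor.mapIso (Equiv.toIso (Equiv.ulift.trans
    ((finProdFinEquiv.symm.trans (Equiv.prodUnique (Fin m) (Fin 1))).trans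
      Equiv.ulift.symm)))).toEquiv

theorem rename_proj {n : ℕ} (i : Fin n) :
    rename T.toFunctor (fun s : Fin (n * 1) => (finProdFinEquiv.symm s).1)
      ((suspension T).proj PUnit.unit (finProdFinEquiv (i, 0))) =
      T.η.app (ULift (Fin n)) ⟨i⟩ := by
  simp only [rename, FSetCat.proj, suspension, instantiate_eq_extend, map_eq_extend, extend_η,
    Equiv.symm_apply_apply]

theorem components_id {n : ℕ} (i : Fin n) :
    components (𝟙 ((theory T).pow n)) i = T.η.app (ULift (Fin n)) ⟨i⟩ :=
  rename_proj i

theorem components_π {n : ℕ} (i : Fin n) (j : Fin 1) :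
    components ((theory T).π n i) j = T.η.app (ULift (Fin n)) ⟨i⟩ :=
  rename_proj i

theorem components_comp {l m n : ℕ} (f : (theory T).pow l ⟶ (theory T).pow m)
    (g : (theory T).pow m ⟶ (theory T).pow n) (i : Fin n) :
    components (f ≫ g) i = extend T (fun s => components f s.down) (components g i) :=
  (instantiate_extend T (g i) (fun s => f (finProdFinEquiv.symm s).1)
    (fun s => ULift.up (finProdFinEquiv.symm s).1)).trans
    (extend_instantiate T (fun s : ULift (Fin m) => components f s.down) (g i)
      (fun s => ULift.up (finProdFinEquiv.symm s).1)).symm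

theorem components_comp_π {m n : ℕ} (f : (theory T).pow m ⟶ (theory T).pow n) (i : Fin n)
    (j : Fin 1) : components (f ≫ (theory T).π n i) j = components f i := by
  rw [components_comp, components_π, extend_η]

theorem components_lift {m n : ℕ} (σ : Fin n → ((theory T).pow m ⟶ (theory T).pow 1))
    (i : Fin n) : components ((theory T).lift σ) i = components (σ i) 0 := by
  rw [← (theory T).lift_π σ i, components_comp_π]

theorem components_map {S : Monad (Type u)} (α : S ⟶ T) {m n : ℕ}
    (f : (theory S).pow m ⟶ (theory S).pow n) (i : Fin n) :
    components ((suspensionMap α).completion.underlying.map f) i =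
      α.app (ULift (Fin m)) (components f i) :=
  (app_instantiate α.toNatTrans (f i) (fun s => ULift.up (finProdFinEquiv.symm s).1)).symm

end Components

/-- The clone of the Lawvere theory of a monad is the clone of the monad. -/
noncomputable def cloneTheoryIso (T : Monad (Type u)) : (theory T).clone ≅ monadClone.obj T :=
  Clone.isoOfEquiv
    (fun _ => components.trans (Equiv.funUnique (Fin 1) _))
    (fun i => components_π i 0)
    (fun _ _ => (components_comp _ _ 0).trans
      (congrArg (extend T · _) (funext fun s => components_lift _ s.down)))

/-- The clone of the Lawvere theory of a finitary monad is naturally the clone of the monad. -/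
noncomputable def theoryFunctorCompToCloneIso :
    theoryFunctor.{u} ⋙ LawvereTheory.toClone ≅ finitaryMonadClone :=
  NatIso.ofComponents (fun T => cloneTheoryIso T.obj) fun {_ T} α => Clone.hom_ext fun n θ =>
    (congrArg (fun f : (theory T.obj).pow n ⟶ (theory T.obj).pow 1 => components f 0)
      ((Category.id_comp _).trans (Category.comp_id _))).trans (components_map α.hom θ 0)

instance : theoryFunctor.{u}.Faithful :=
  have := Functor.Faithful.of_iso theoryFunctorCompToCloneIso.{u}.symm
  Functor.Faithful.of_comp theoryFunctor LawvereTheory.toClone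

instance : theoryFunctor.{u}.Full :=
  have := Functor.Full.of_iso theoryFunctorCompToCloneIso.{u}.symm
  Functor.Full.of_comp_faithful theoryFunctor LawvereTheory.toClone

instance : theoryFunctor.{u}.EssSurj where
  mem_essImage L := ⟨finitaryMonadClone.objPreimage (LawvereTheory.toClone.obj L),
    ⟨LawvereTheory.toClone.preimageIso (theoryFunctorCompToCloneIso.app _ ≪≫
      finitaryMonadClone.objObjPreimageIso _)⟩⟩

instance : theoryFunctor.{u}.IsEquivalence where

/-! ### Algebras for a monad as models of its Lawvere theory -/

section AlgebraToModel

variable {T : Monad (Type u)}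

theorem algebra_a_extend (A : T.Algebra) {X : Type u} (f : X → T.obj A.A) (t : T.obj X) :
    A.a (extend T f t) = A.a (T.map (↾fun x => A.a (f x)) t) :=
  (ConcreteCategory.congr_hom A.assoc (T.map (↾f) t)).trans
    (congrArg A.a (ConcreteCategory.congr_hom (T.map_comp (↾f) A.a) t).symm)

theorem algebra_a_instantiate_η (A : T.Algebra) {n : ℕ} (i : Fin n) (x : Fin n → A.A) :
    A.a (instantiate T.toFunctor (T.η.app (ULift (Fin n)) ⟨i⟩) x) = x i := by
  rw [instantiate_η]
  exact ConcreteCategory.congr_hom A.unit (x i)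

theorem algebra_a_instantiate_extend (A : T.Algebra) {m n : ℕ} (θ : T.obj (ULift (Fin m)))
    (σ : Fin m → T.obj (ULift (Fin n))) (x : Fin n → A.A) :
    A.a (instantiate T.toFunctor (extend T (fun s => σ s.down) θ) x) =
      A.a (instantiate T.toFunctor θ fun i => A.a (instantiate T.toFunctor (σ i) x)) := by
  rw [instantiate_extend]
  exact algebra_a_extend A _ θ

theorem algebraHom_a_instantiate {A B : T.Algebra} (g : A ⟶ B) {n : ℕ}
    (θ : T.obj (ULift (Fin n))) (x : Fin n → A.A) :
    g.f (A.a (instantiate T.toFunctor θ x)) =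
      B.a (instantiate T.toFunctor θ fun i => g.f (x i)) :=
  (ConcreteCategory.congr_hom g.h _).symm.trans
    (congrArg B.a (map_instantiate T.toFunctor g.f θ x))

/-- The functor `X ^ n ↦ A ^ n` on the Lawvere theory of a monad, for an algebra `A`. -/
def algebraPowers (A : T.Algebra) : (theory T).Obj ⥤ Type u where
  obj X := Fin X.obj.exp → A.A
  map {X Y} f := ↾fun x i => A.a (instantiate T.toFunctor
    (components (m := X.obj.exp) (n := Y.obj.exp) f i) x)
  map_id X := ConcreteCategory.hom_ext _ _ fun x => funext fun i =>
    (congrArg (fun θ => A.a (instantiate T.toFunctor θ x))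
      (components_id (n := X.obj.exp) i)).trans (algebra_a_instantiate_η A i x)
  map_comp {X Y Z} f g := ConcreteCategory.hom_ext _ _ fun x => funext fun i =>
    (congrArg (fun θ => A.a (instantiate T.toFunctor θ x))
      (components_comp (l := X.obj.exp) (m := Y.obj.exp) (n := Z.obj.exp) f g i)).trans
      (algebra_a_instantiate_extend A _ _ x)

theorem algebraPowers_map_components_symm (A : T.Algebra) {n : ℕ} (θ : T.obj (ULift (Fin n)))
    (x : Fin n → A.A) :
    (algebraPowers A).map (components.symm fun _ : Fin 1 => θ) x =
      fun _ : Fin 1 => A.a (instantiate T.toFunctor θ x) :=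
  funext fun i => congrArg (fun θ => A.a (instantiate T.toFunctor θ x))
    (congrFun (components.apply_symm_apply fun _ : Fin 1 => θ) i)

theorem algebraPowers_map_π (A : T.Algebra) {n : ℕ} (x : Fin n → A.A) (i : Fin n) :
    (algebraPowers A).map ((theory T).π n i) x = fun _ => x i :=
  funext fun j => (congrArg (fun θ => A.a (instantiate T.toFunctor θ x))
    (components_π i j)).trans (algebra_a_instantiate_η A i x)

theorem isModel_algebraPowers (A : T.Algebra) : (theory T).isModel (algebraPowers A) := by
  refine preservesFiniteProducts_of_powers (theory T).π _ (theory T).pow_bijective.2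
    (theory T).isPower fun n => (fan_isLimit_iff _ _).2 fun Z => ⟨fun g g' e => ?_, fun k => ?_⟩
  · refine ConcreteCategory.hom_ext _ _ fun z => funext fun i => ?_
    have map_π_eq := ConcreteCategory.congr_hom (congrFun e i) z
    exact congrFun ((algebraPowers_map_π A (g z) i).symm.trans
      (map_π_eq.trans (algebraPowers_map_π A (g' z) i))) (0 : Fin 1)
  · refine ⟨↾fun z i => k i z (0 : Fin 1), funext fun i => ConcreteCategory.hom_ext _ _ fun z =>
      (algebraPowers_map_π A _ i).trans (funext fun j => ?_)⟩
    exact congrArg (k i z) (Subsingleton.elim (α := Fin 1) _ _)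

variable (T) in
/-- The comparison functor from algebras for a monad to models of its Lawvere theory. -/
def algebraToModel : T.Algebra ⥤ (theory T).Model where
  obj A := ⟨algebraPowers A, isModel_algebraPowers A⟩
  map g := ObjectProperty.homMk
    { app _ := ↾fun x i => g.f (x i)
      naturality _ _ _ := ConcreteCategory.hom_ext _ _ fun x => funext fun _ =>
        algebraHom_a_instantiate g _ x }

instance : (algebraToModel T).Faithful where
  map_injective {A B _ _} h := Monad.Algebra.Hom.ext (ConcreteCategory.hom_ext _ _ fun a =>
    congrFun (congrArg (fun β : (algebraToModel T).obj A ⟶ (algebraToModel T).obj B =>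
      β.hom.app ((theory T).pow 1) fun _ => a) h) (0 : Fin 1))

theorem algebraToModel_full (hT : IsFinitelySupported T.toFunctor) : (algebraToModel T).Full where
  map_surjective {A B} β := by
    let g (a : A.A) : B.A := (show Fin 1 → B.A from β.hom.app ((theory T).pow 1) fun _ => a) 0
    have app_pow {n : ℕ} (x : Fin n → A.A) :
        β.hom.app ((theory T).pow n) x = fun i => g (x i) := funext fun i => by
      have naturality_π := ConcreteCategory.congr_hom (β.hom.naturality ((theory T).π n i)) x
      have map_π_left := congrArg (β.hom.app ((theory T).pow 1)) (algebraPowers_map_π A x i)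
      have map_π_right := algebraPowers_map_π B (β.hom.app ((theory T).pow n) x) i
      exact (congrFun (map_π_left.symm.trans (naturality_π.trans map_π_right)) (0 : Fin 1)).symm
    have g_a (t : T.obj A.A) : B.a (T.map (↾g) t) = g (A.a t) := by
      obtain ⟨n, θ, x, rfl⟩ := hT t
      let f : (theory T).pow n ⟶ (theory T).pow 1 := components.symm fun _ => θ
      have naturality_f := ConcreteCategory.congr_hom (β.hom.naturality f) x
      calc B.a (T.map (↾g) (instantiate T.toFunctor θ x))
        _ = B.a (instantiate T.toFunctor θ fun i => g (x i)) :=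
          congrArg B.a (map_instantiate T.toFunctor (↾g) θ x)
        _ = (show Fin 1 → B.A from (algebraPowers B).map f fun i => g (x i)) 0 :=
          (congrFun (algebraPowers_map_components_symm B θ _) (0 : Fin 1)).symm
        _ = (show Fin 1 → B.A from
              β.hom.app ((theory T).pow 1) ((algebraPowers A).map f x)) 0 :=
          congrFun ((congrArg ((algebraPowers B).map f) (app_pow x)).symm.trans
            naturality_f.symm) (0 : Fin 1)
        _ = g (A.a (instantiate T.toFunctor θ x)) :=
          congrFun ((congrArg (β.hom.app ((theory T).pow 1))
            (algebraPowers_map_components_symm A θ x))) (0 : Fin 1)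
    refine ⟨{ f := ↾g, h := ConcreteCategory.hom_ext _ _ g_a }, ObjectProperty.hom_ext _
      (NatTrans.ext (funext fun X => ConcreteCategory.hom_ext _ _ fun x => (app_pow x).symm))⟩

end AlgebraToModel

/-! ### Models as algebras -/

namespace LawvereTheory.Model

variable {L : LawvereTheory.{u}} (M : L.Model)

theorem map_π_bijective (n : ℕ) : Function.Bijective
    (fun (a : M.obj.obj (L.pow n)) (i : Fin n) => M.obj.map (L.π n i) a) := by
  have : PreservesFiniteProducts M.obj := M.property
  obtain ⟨h⟩ := L.isPower n
  have isPower_map := (fan_isLimit_iff _ _).1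
    ⟨Fan.isLimitMapConeEquiv M.obj _ _ (isLimitOfPreserves M.obj h)⟩ PUnit
  refine ⟨fun a b e => ?_, fun x => ?_⟩
  · exact ConcreteCategory.congr_hom (isPower_map.1 (a₁ := ↾fun _ => a) (a₂ := ↾fun _ => b)
      (funext fun i => ConcreteCategory.hom_ext _ _ fun _ => congrFun e i)) PUnit.unit
  · obtain ⟨g, hg⟩ := isPower_map.2 (fun i => ↾fun _ => x i)
    exact ⟨g PUnit.unit, funext fun i => ConcreteCategory.congr_hom (congrFun hg i) PUnit.unit⟩

/-- The element of the value of a model at `X ^ n` with given components. -/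
noncomputable def tuple {n : ℕ} : (Fin n → M.obj.obj (L.pow 1)) ≃ M.obj.obj (L.pow n) :=
  (Equiv.ofBijective _ (M.map_π_bijective n)).symm

theorem map_π_tuple {n : ℕ} (x : Fin n → M.obj.obj (L.pow 1)) (i : Fin n) :
    M.obj.map (L.π n i) (M.tuple x) = x i :=
  congrFun ((Equiv.ofBijective _ (M.map_π_bijective n)).apply_symm_apply x) i

theorem map_comp_apply {X Y Z : L.Obj} (f : X ⟶ Y) (g : Y ⟶ Z) (a : M.obj.obj X) :
    M.obj.map (f ≫ g) a = M.obj.map g (M.obj.map f a) :=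
  ConcreteCategory.congr_hom (M.obj.map_comp f g) a

theorem map_eq_tuple {Z : L.Obj} {n : ℕ} (f : Z ⟶ L.pow n) (a : M.obj.obj Z) :
    M.obj.map f a = M.tuple fun i => M.obj.map (f ≫ L.π n i) a :=
  (M.map_π_bijective n).1 (funext fun i =>
    (M.map_comp_apply f _ a).symm.trans
      (M.map_π_tuple (fun i => M.obj.map (f ≫ L.π n i) a) i).symm)

/-- The operations of a Lawvere theory act on the value `A` of a model at the distinguished object.
The clone of all operations on `A` is that of the continuation monad. -/
noncomputable def cloneHom :
    L.clone ⟶ monadClone.obj (ofTypeMonad (Cont (M.obj.obj (L.pow 1)))) where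
  app n θ := fun k : ULift (Fin n) → M.obj.obj (L.pow 1) =>
    M.obj.map θ (M.tuple fun i => k ⟨i⟩)
  app_var i := funext fun _ => M.map_π_tuple _ i
  app_subst θ σ := funext fun k => (M.map_comp_apply _ θ _).trans (congrArg (M.obj.map θ)
    ((M.map_eq_tuple _ _).trans (congrArg M.tuple (funext fun i =>
      congrArg (M.obj.map · (M.tuple fun j => k ⟨j⟩)) (L.lift_π σ i)))))

end LawvereTheory.Model

/-- Evaluation of continuations at the identity, as an algebra structure on the answer type. -/
def contAlgebra (A : Type u) : (ofTypeMonad (Cont A)).Algebra where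
  A := A
  a := ↾fun t : Cont A A => t.run id
  unit := rfl
  assoc := rfl

section EssSurj

variable {T : Monad (Type u)} {M : (theory T).Model}
  {α : T ⟶ ofTypeMonad (Cont (M.obj.obj ((theory T).pow 1)))}

theorem a_instantiate_components
    (hα : (cloneTheoryIso T).hom ≫ monadClone.map α = M.cloneHom) {n : ℕ}
    (f : (theory T).pow n ⟶ (theory T).pow 1) (x : Fin n → M.obj.obj ((theory T).pow 1)) :
    ((Monad.algebraFunctorOfMonadHom α).obj (contAlgebra _)).a
      (instantiate T.toFunctor (components f 0) x) = M.obj.map f (M.tuple x) :=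
  congrFun ((app_instantiate α.toNatTrans (components f 0) x).trans
    (congrArg (instantiate (ofTypeMonad (Cont _)).toFunctor · x)
      (congrArg (fun φ : (theory T).clone ⟶ monadClone.obj (ofTypeMonad (Cont _)) =>
        Clone.Hom.app φ n f) hα))) id

/-- A model is isomorphic to the powers of the algebra obtained from its action. -/
noncomputable def algebraPowersIso
    (hα : (cloneTheoryIso T).hom ≫ monadClone.map α = M.cloneHom) :
    algebraPowers ((Monad.algebraFunctorOfMonadHom α).obj (contAlgebra _)) ≅ M.obj :=
  let B := (Monad.algebraFunctorOfMonadHom α).obj (contAlgebra _)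
  NatIso.ofComponents (fun X => (M.tuple (n := X.obj.exp)).toIso) fun {X Y} f =>
    ConcreteCategory.hom_ext _ _ fun x => Eq.symm <|
      (M.map_eq_tuple (n := Y.obj.exp) f (M.tuple (n := X.obj.exp) x)).trans
        (congrArg M.tuple (funext fun i =>
          (a_instantiate_components hα _ x).symm.trans
            (congrArg (fun θ => B.a (instantiate T.toFunctor θ x))
              (components_comp_π (m := X.obj.exp) (n := Y.obj.exp) f i 0))))

theorem algebraToModel_essSurj (hT : IsFinitelySupported T.toFunctor) :
    (algebraToModel T).EssSurj where
  mem_essImage M := by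
    obtain ⟨α, hα⟩ := exists_monadHom_extending hT ((cloneTheoryIso T).inv ≫ M.cloneHom)
    exact ⟨_, ⟨ObjectProperty.isoMk _ (algebraPowersIso ((Iso.eq_inv_comp _).1 hα))⟩⟩

end EssSurj

theorem algebraToModel_isEquivalence {T : Monad (Type u)} (hT : isFinitary T) :
    (algebraToModel T).IsEquivalence :=
  have hT := (isFinitary_iff_isFinitelySupported T).1 hT
  { full := algebraToModel_full hT
    essSurj := algebraToModel_essSurj hT }

/-! ### Pseudonaturality of the comparison -/

/-- The comparison functors are natural in the monad, at a given algebra. -/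
def algebraPowersRestrictIso {S T : Monad (Type u)} (α : S ⟶ T) (A : T.Algebra) :
    algebraPowers ((Monad.algebraFunctorOfMonadHom α).obj A) ≅
      (suspensionMap α).completion.underlying ⋙ algebraPowers A :=
  NatIso.ofComponents (fun X => Iso.refl (Fin X.obj.exp → A.A)) fun {X Y} f =>
    ConcreteCategory.hom_ext _ _ fun x => funext fun i =>
      (congrArg A.a (app_instantiate α.toNatTrans _ x)).trans
        (congrArg (fun θ => A.a (instantiate T.toFunctor θ x))
          (components_map (m := X.obj.exp) (n := Y.obj.exp) α f i).symm)

/-- The comparison functors are natural in the monad. -/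
def algebraToModelRestrictIso {S T : FinitaryMonad.{u}} (α : S ⟶ T) :
    Monad.algebraFunctorOfMonadHom α.hom ⋙ algebraToModel S.obj ≅
      algebraToModel T.obj ⋙ LawvereTheory.Model.restrict (theoryFunctor.map α) :=
  NatIso.ofComponents (fun A => ObjectProperty.isoMk _ (algebraPowersRestrictIso α.hom A))
    fun _ => rfl

/-- The pseudonatural transformation from algebras for a finitary monad to models of its Lawvere
theory. -/
def algebrasToModels : Pseudofunctor.StrongTrans algebras.{u}.toPseudofunctor'
    (theoryFunctor.{u}.op ⋙ LawvereTheory.models).toPseudofunctor' where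
  app T := (algebraToModel T.as.unop.obj).toCatHom
  naturality f := Cat.Hom.isoMk (algebraToModelRestrictIso f.as.unop)
  naturality_naturality {_ _ f _} η := by
    obtain rfl := LocallyDiscrete.eq_of_hom η
    obtain rfl : η = 𝟙 f := Subsingleton.elim _ _
    apply Cat.Hom₂.ext
    ext A
    exact ObjectProperty.hom_ext _ rfl
  naturality_id _ := by
    apply Cat.Hom₂.ext
    ext A
    exact ObjectProperty.hom_ext _ rfl
  naturality_comp _ _ := by
    apply Cat.Hom₂.ext
    ext A
    exact ObjectProperty.hom_ext _ rfl

end MonadTheory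

theorem mainTheorem1 :
    ∃ e : MonadTheory.FinitaryMonad.{u} ≌ MonadTheory.LawvereTheory.{u},
      Nonempty (e.functor ≅ MonadTheory.theoryFunctor.{u}) ∧
      ∃ η : Pseudofunctor.StrongTrans
          (MonadTheory.algebras.{u}).toPseudofunctor'
          (e.functor.op ⋙ MonadTheory.LawvereTheory.models.{u}).toPseudofunctor',
        ∀ T, (η.app T).toFunctor.IsEquivalence :=
  ⟨MonadTheory.theoryFunctor.asEquivalence, ⟨Iso.refl _⟩, MonadTheory.algebrasToModels,
    fun T => MonadTheory.algebraToModel_isEquivalence T.as.unop.property⟩
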